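/- Let $d\ge 2$ and equip $\mathbb{R}^d$ with the norm $\|x\|_\infty=\max_i|x_i|$; let $B(x,r)$ be the closed ball of center $x$ and radius $r$. For a Borel probability measure $\mu$ on $\mathbb{R}^d$ define its lower and upper dimensions by $$\underline{\dim}(\mu)=\sup\{\alpha\ge 0:\ \text{for } \mu\text{-a.e. } x\ \exists\, r_x>0\ \forall\, 0<r<r_x,\ \mu(B(x,r))\le r^\alpha\},$$ $$\overline{\dim}(\mu)=\inf\{\beta\ge 0:\ \text{for } \mu\text{-a.e. } x\ \exists\, r_x>0\ \forall\, 0<r<r_x,\ \mu(B(x,r))\ge r^\beta\}.$$ For $0<r<1$ and $\delta\ge 1$ put $A(x,r,\delta)=B(x,r)\setminus B(x,r-r^\delta)$, and let $E_\mu(\delta,\eta)$ be the set of all $x\in\mathbb{R}^d$ for which there is a sequence $r_n\in(0,1)$ with $r_n\to 0$ and $$\mu(A(x,r_n,\delta))\ge \eta\,\mu(B(x,r_n))\quad\text{for every } n.$$ Then for all real numbers $\underline d,\overline d$ with $0\le\underline d\le d-1$ and $\underline d\le\overline d\le d$, every $\eta\in(0,1)$ and every $\delta>1$, there exists a probability measure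 $\mu$ on $\mathbb{R}^d$ without atoms such that $\underline{\dim}(\mu)=\underline d$, $\overline{\dim}(\mu)=\overline d$ and $\mu(E_\mu(\delta,\eta))=1$. -/

import Mathlib

open MeasureTheory Filter Topology

noncomputable section

/-- The annulus `A(x, r, δ) = B(x, r) \ B(x, r - r ^ δ)`, with closed balls. On `Fin d → ℝ` the
Mathlib metric is the one of the norm `max |x i|`. -/
def annulus {d : ℕ} (x : Fin d → ℝ) (r δ : ℝ) : Set (Fin d → ℝ) :=
  Metric.closedBall x r \ Metric.closedBall x (r - r ^ δ)

/-- The property `P_μ(x, r, δ, η)`: the annulus carries at least the proportion `η` of the mass of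
the ball. -/
def AnnulusCharged {d : ℕ} (μ : Measure (Fin d → ℝ)) (x : Fin d → ℝ) (r δ η : ℝ) : Prop :=
  ENNReal.ofReal η * μ (Metric.closedBall x r) ≤ μ (annulus x r δ)

/-- The set `E_μ(δ, η)` of those `x` for which `P_μ(x, r n, δ, η)` holds along some sequence of
radii `r n ∈ (0, 1)` tending to `0`. -/
def thinAnnuliSet {d : ℕ} (μ : Measure (Fin d → ℝ)) (δ η : ℝ) : Set (Fin d → ℝ) :=
  {x | ∃ r : ℕ → ℝ, (∀ n, 0 < r n ∧ r n < 1) ∧ Tendsto r atTop (𝓝 0) ∧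
    ∀ n, AnnulusCharged μ x (r n) δ η}

/-- The lower dimension of `μ`. The supremum is taken in the extended reals, so that it is a genuine
supremum for every measure. -/
def lowerDim {d : ℕ} (μ : Measure (Fin d → ℝ)) : EReal :=
  sSup ((fun α : ℝ => (α : EReal)) '' {α : ℝ | 0 ≤ α ∧ ∀ᵐ x ∂μ, ∃ ρ : ℝ, 0 < ρ ∧
    ∀ r : ℝ, 0 < r → r < ρ → μ (Metric.closedBall x r) ≤ ENNReal.ofReal (r ^ α)})

/-- The upper dimension of `μ`. The infimum is taken in the extended reals, so that it is `⊤` when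
no exponent `β` is admissible. -/
def upperDim {d : ℕ} (μ : Measure (Fin d → ℝ)) : EReal :=
  sInf ((fun β : ℝ => (β : EReal)) '' {β : ℝ | 0 ≤ β ∧ ∀ᵐ x ∂μ, ∃ ρ : ℝ, 0 < ρ ∧
    ∀ r : ℝ, 0 < r → r < ρ → ENNReal.ofReal (r ^ β) ≤ μ (Metric.closedBall x r)})

end

/-!
The measure is a product `μ = ν 0 ⊗ ⋯ ⊗ ν (d - 1)` on `ℝ ^ d`, where `ν i` is the law of a random
number in `[0, 1]` with independent binary digits. Closed balls of the maximum norm are cubes, so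
the mass of a ball is the product of the masses of intervals.

*Dimensions.* In each factor a digit is either free (fair), fixed (equal to `0`), or, in the first
factor only and very rarely, biased (equal to `1` with probability `2 ^ (-c) ≤ 1 - η`). A ball of
radius `2 ^ (-k)` around a point of the support then has mass `2 ^ (-N k)`, where `N k` is the
total number of free digits among the first `k` of all factors, up to a bounded factor and a
contribution of the biased digits that is subexponential in `k` (`digitMeasure_closedBall_le`,
`le_digitMeasure_closedBall`). The two dimensions are therefore the lower and the upper density
of the free digits (`lowerDim_eq_of_dyadic`, `upperDim_eq_of_dyadic`). The positions between `(2 n)!`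
and `(2 n + 1)!` are low and those between `(2 n + 1)!` and `(2 n + 2)!` are high; since consecutive
factorials have unbounded ratio, free digits of total rate `dl` at low and `du` at high positions
have lower density `dl` and upper density `du`.

*Thin annuli.* At low positions the first factor has no free digit, which is possible because
`dl ≤ d - 1`; its rate at high positions is whatever the others, at rate at most `1`, leave of
`du`. At the beginning of each low block, at position `m = (2 n + 2)! + 1`, it has a biased digit.
The first coordinate of a point whose biased digit is `1` sees, at distance
`2 ^ (-m - 1)` up to an error `2 ^ (-L)` with `L = (2 n + 3)!`, the points that share its first `m`
digits and have biased digit `0`; these carry all but a proportion `2 ^ (-c)` of the mass of the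
interval. As `L` is eventually larger than any multiple of `m`, they lie in the annulus
(`digitMeasure_inner_ball_le`). Almost surely the biased digit is `1` infinitely often
(`ae_frequently_eq_one`). There are no atoms, since a point surrounded by arbitrarily small
charged annuli cannot be one (`measure_singleton_of_mem_thinAnnuliSet`).
-/

noncomputable section

open ProbabilityTheory unitInterval
open scoped Nat Classical

/-! ### Numbers with independent binary digits -/

/-- The law of a sequence of independent bits, the `j`-th of which is `1` with probability `q j`. -/
def bitMeasure (q : ℕ → I) : Measure (ℕ → Fin 2) :=
  Measure.infinitePi fun j => bernoulliMeasure (1 : Fin 2) 0 (q j)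

instance (q : ℕ → I) : IsProbabilityMeasure (bitMeasure q) := by
  unfold bitMeasure; infer_instance

/-- The law of the real number whose binary digits are independent, the `j`-th digit after the
binary point (counted from `0`) being `1` with probability `q j`. -/
def digitMeasure (q : ℕ → I) : Measure ℝ :=
  (bitMeasure q).map Real.ofDigits

lemma measurable_ofDigits_two : Measurable (Real.ofDigits (b := 2)) :=
  Real.continuous_ofDigits.measurable

instance (q : ℕ → I) : IsProbabilityMeasure (digitMeasure q) :=
  Measure.isProbabilityMeasure_map measurable_ofDigits_two.aemeasurable

lemma digitMeasure_closedBall (q : ℕ → I) (x r : ℝ) :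
    digitMeasure q (Metric.closedBall x r) =
      bitMeasure q {ω | |Real.ofDigits ω - x| ≤ r} := by
  rw [digitMeasure, Measure.map_apply measurable_ofDigits_two
    Metric.isClosed_closedBall.measurableSet]
  rfl

lemma bitMeasure_agree (q : ℕ → I) (c : ℕ → Fin 2) (k : ℕ) :
    bitMeasure q {ω | ∀ j < k, ω j = c j} =
      ∏ j ∈ Finset.range k, bernoulliMeasure (1 : Fin 2) 0 (q j) {c j} := by
  rw [bitMeasure, ← Measure.infinitePi_pi _ (fun i _ => measurableSet_singleton _)]
  congr 1
  ext ω
  simp [Set.mem_pi]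

/-- The integer written in binary by the first `k` digits of `ω`. -/
def prefixNat (ω : ℕ → Fin 2) : ℕ → ℕ
  | 0 => 0
  | k + 1 => 2 * prefixNat ω k + ω k

lemma prefixNat_eq_iff {ω ω' : ℕ → Fin 2} {k : ℕ} :
    prefixNat ω k = prefixNat ω' k ↔ ∀ j < k, ω j = ω' j := by
  induction k with
  | zero => simp [prefixNat]
  | succ k ih =>
    rw [Nat.forall_lt_succ_right, ← ih, prefixNat, prefixNat, Fin.ext_iff]
    have := (ω k).isLt
    have := (ω' k).isLt
    omega

lemma ofDigits_eq_prefixNat (ω : ℕ → Fin 2) (k : ℕ) :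
    Real.ofDigits ω = (prefixNat ω k + Real.ofDigits fun i => ω (i + k)) * ((2 : ℝ) ^ k)⁻¹ := by
  have h : ∀ k, ∑ i ∈ Finset.range k, Real.ofDigitsTerm ω i = prefixNat ω k * ((2 : ℝ) ^ k)⁻¹ := by
    intro k
    induction k with
    | zero => simp [prefixNat]
    | succ k ih =>
      rw [Finset.sum_range_succ, ih, prefixNat, Real.ofDigitsTerm]
      push_cast
      field
  rw [Real.ofDigits_eq_sum_add_ofDigits ω k, h]
  push_cast
  ring

lemma bernoulli_singleton_le {q : I} (hq : (q : ℝ) ≤ 1 / 2) (c : Fin 2) :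
    bernoulliMeasure (1 : Fin 2) 0 q {c} ≤ ENNReal.ofReal (1 - q) := by
  have h0 := q.2.1
  rw [← ENNReal.ofReal_toReal (measure_ne_top _ {c}), ← measureReal_def]
  apply ENNReal.ofReal_le_ofReal
  fin_cases c
  · simp
  · simp; linarith

/-- When `0` is the likelier value of each digit, no integer is the prefix of length `k` with
probability larger than that of the zero prefix, and a ball of radius `2 ^ (-k)` meets at most four
dyadic intervals of that level. -/
lemma digitMeasure_closedBall_le {q : ℕ → I} (hq : ∀ j, (q j : ℝ) ≤ 1 / 2) (x : ℝ) (k : ℕ) :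
    digitMeasure q (Metric.closedBall x ((2 : ℝ) ^ k)⁻¹) ≤
      4 * ∏ j ∈ Finset.range k, ENNReal.ofReal (1 - q j) := by
  have key : ∀ a : ℤ, bitMeasure q {ω | (prefixNat ω k : ℤ) = a} ≤
      ∏ j ∈ Finset.range k, ENNReal.ofReal (1 - q j) := by
    intro a
    by_cases h : ∃ c, (prefixNat c k : ℤ) = a
    · obtain ⟨c, rfl⟩ := h
      simp only [Nat.cast_inj, prefixNat_eq_iff]
      rw [bitMeasure_agree]
      exact Finset.prod_le_prod' fun j _ => bernoulli_singleton_le (hq j) _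
    · push Not at h
      simp [h]
  rw [digitMeasure_closedBall]
  set A : ℤ := ⌈2 ^ k * x - 2⌉ with hA
  have hsub : {ω : ℕ → Fin 2 | |Real.ofDigits ω - x| ≤ ((2 : ℝ) ^ k)⁻¹} ⊆
      ⋃ a ∈ Finset.Icc A (A + 3), {ω | (prefixNat ω k : ℤ) = a} := by
    intro ω hω
    have hpos : (0 : ℝ) < 2 ^ k := by positivity
    have h0 := Real.ofDigits_nonneg fun i => ω (i + k)
    have h1 := Real.ofDigits_le_one fun i => ω (i + k)
    have h2 : |(prefixNat ω k + Real.ofDigits fun i => ω (i + k)) - 2 ^ k * x| ≤ 1 := by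
      have : (prefixNat ω k + Real.ofDigits fun i => ω (i + k)) - 2 ^ k * x =
          2 ^ k * (Real.ofDigits ω - x) := by
        rw [ofDigits_eq_prefixNat ω k]; field
      rw [this, abs_mul, abs_of_pos hpos]
      calc _ ≤ (2 : ℝ) ^ k * (2 ^ k)⁻¹ := by gcongr; exact hω
        _ = 1 := by field
    rw [abs_le] at h2
    simp only [Set.mem_iUnion, Set.mem_ofPred_eq, exists_prop, exists_eq_right', Finset.mem_Icc]
    constructor
    · rw [hA, Int.ceil_le]; push_cast; linarith
    · have := Int.le_ceil ((2 : ℝ) ^ k * x - 2)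
      rw [← hA] at this
      have : (prefixNat ω k : ℝ) ≤ A + 3 := by linarith
      exact_mod_cast this
  calc _ ≤ _ := measure_mono hsub
    _ ≤ _ := measure_biUnion_finset_le _ _
    _ ≤ _ := Finset.sum_le_card_nsmul _ _ _ fun a _ => key a
    _ = _ := by
      rw [Int.card_Icc, nsmul_eq_mul]
      congr 1
      rw [show A + 3 + 1 - A = 4 by ring]
      rfl

lemma le_digitMeasure_closedBall (q : ℕ → I) (ω : ℕ → Fin 2) (k : ℕ) :
    ∏ j ∈ Finset.range k, bernoulliMeasure (1 : Fin 2) 0 (q j) {ω j} ≤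
      digitMeasure q (Metric.closedBall (Real.ofDigits ω) ((2 : ℝ) ^ k)⁻¹) := by
  rw [digitMeasure_closedBall, ← bitMeasure_agree]
  exact measure_mono fun ω' h => by simpa using Real.abs_ofDigits_sub_ofDigits_le h

lemma ae_bitMeasure_singleton_ne_zero (q : ℕ → I) :
    ∀ᵐ ω ∂bitMeasure q, ∀ j, bernoulliMeasure (1 : Fin 2) 0 (q j) {ω j} ≠ 0 := by
  rw [ae_all_iff]
  intro j
  have h := (measurePreserving_eval_infinitePi
    (fun j => bernoulliMeasure (1 : Fin 2) 0 (q j)) j).quasiMeasurePreserving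
  refine h.ae (p := fun c => bernoulliMeasure (1 : Fin 2) 0 (q j) {c} ≠ 0) ?_
  rw [ae_iff_of_countable]
  exact fun c hc => hc

/-- An almost sure property of the digits holds almost everywhere for the law of the number. No
measurability is needed, because the image of a closed set of digit sequences is compact. -/
lemma ae_digitMeasure {q : ℕ → I} {p : ℝ → Prop}
    (h : ∀ᵐ ω ∂bitMeasure q, p (Real.ofDigits ω)) : ∀ᵐ x ∂digitMeasure q, p x := by
  obtain ⟨N, hN, hNm, hN0⟩ := exists_measurable_superset_of_null (ae_iff.1 h)
  rw [ae_iff, ← nonpos_iff_eq_zero]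
  refine ENNReal.le_of_forall_pos_le_add fun ε hε _ => ?_
  obtain ⟨K, hKN, hK, hlt⟩ := hNm.compl.exists_isClosed_lt_add (μ := bitMeasure q)
    (measure_ne_top _ _) (ENNReal.coe_pos.2 hε).ne'
  have hKc : IsCompact (Real.ofDigits '' K) :=
    hK.isCompact.image Real.continuous_ofDigits
  have hN1 : bitMeasure q Nᶜ = 1 := by rw [prob_compl_eq_one_iff hNm, hN0]
  calc digitMeasure q {x | ¬ p x} ≤ digitMeasure q (Real.ofDigits '' K)ᶜ := by
        apply measure_mono
        rintro x hx ⟨ω, hω, rfl⟩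
        exact hKN hω (hN hx)
    _ = bitMeasure q (Real.ofDigits ⁻¹' (Real.ofDigits '' K)ᶜ) :=
        Measure.map_apply measurable_ofDigits_two hKc.measurableSet.compl
    _ ≤ bitMeasure q Kᶜ := by
        apply measure_mono
        intro ω hω hωK
        exact hω ⟨ω, hωK, rfl⟩
    _ ≤ 0 + ε := by
        rw [prob_compl_eq_one_sub hK.measurableSet, zero_add, tsub_le_iff_left, ← hN1]
        exact hlt.le

/-- Infinitely many independent digits with the same positive probability of being `1` are almost
surely equal to `1` infinitely often: the first `K` of them from a given one on all vanish with
probability `(1 - p) ^ K`. -/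
lemma ae_frequently_eq_one {q : ℕ → I} {m : ℕ → ℕ} (hm : Function.Injective m) {p : I}
    (hp : 0 < p) (hq : ∀ n, q (m n) = p) :
    ∀ᵐ ω ∂bitMeasure q, ∃ᶠ n in atTop, ω (m n) = 1 := by
  simp only [frequently_atTop, ae_all_iff]
  intro N
  have hle : ∀ K : ℕ, bitMeasure q {ω | ¬ ∃ n ≥ N, ω (m n) = 1} ≤ ENNReal.ofReal (1 - p) ^ K := by
    intro K
    calc _ ≤ bitMeasure q (Set.pi (((Finset.Ico N (N + K)).image m : Finset ℕ) : Set ℕ)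
          fun _ => {(0 : Fin 2)}) := by
          apply measure_mono
          intro ω hω
          simp only [Set.mem_ofPred_eq, not_exists, not_and] at hω
          intro j hj
          obtain ⟨n, hn, rfl⟩ := Finset.mem_image.1 (Finset.mem_coe.1 hj)
          have := hω n (Finset.mem_Ico.1 hn).1
          simp only [Set.mem_singleton_iff]
          omega
      _ = ∏ j ∈ (Finset.Ico N (N + K)).image m, bernoulliMeasure (1 : Fin 2) 0 (q j) {0} :=
          Measure.infinitePi_pi _ fun i _ => measurableSet_singleton _
      _ = ∏ n ∈ Finset.Ico N (N + K), ENNReal.ofReal (1 - p) := by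
          rw [Finset.prod_image hm.injOn]
          refine Finset.prod_congr rfl fun n _ => ?_
          rw [← ENNReal.ofReal_toReal (measure_ne_top _ {0}), ← measureReal_def, hq]
          simp
      _ = _ := by simp
  have hlt : ENNReal.ofReal (1 - p) < 1 := by
    rw [ENNReal.ofReal_lt_one]
    have : (0 : ℝ) < p := hp
    linarith
  rw [ae_iff, ← nonpos_iff_eq_zero]
  exact ge_of_tendsto' (ENNReal.tendsto_pow_atTop_nhds_zero_of_lt_one hlt) hle

/-- Suppose that the digit `m + 1` of a point `x` is `1`, which happens with probability
`p = q (m + 1)`, and that digit `m` and the digits strictly between `m + 1` and `L` are almost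
surely `0`. Almost all points that share the first `m + 1` digits of `x` lie in the ball around `x`
of radius `r = 2 ^ (-m - 2) + 2 ^ (-L)`. Those among them whose digit `m + 1` is `0`, a proportion
`1 - p`, are at distance at least `2 ^ (-m - 2) - 2 ^ (-L) > r - r ^ δ` from `x`, and so are almost
all points with another prefix, because digit `m` vanishes. -/
lemma digitMeasure_inner_ball_le {q : ℕ → I} {ω : ℕ → Fin 2} {m L : ℕ} {δ r : ℝ} (hδ : 0 < δ)
    (hω : ∀ j, bernoulliMeasure (1 : Fin 2) 0 (q j) {ω j} ≠ 0)
    (h1 : ω (m + 1) = 1) (hq : q m = 0) (hq' : ∀ j, m + 1 < j → j < L → q j = 0)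
    (hL : (m + 2) * δ < L - 1) (hmL : m + 2 ≤ L)
    (hr : r = ((2 : ℝ) ^ (m + 2))⁻¹ + ((2 : ℝ) ^ L)⁻¹) :
    digitMeasure q (Metric.closedBall (Real.ofDigits ω) (r - r ^ δ)) ≤
      ENNReal.ofReal (q (m + 1)) * digitMeasure q (Metric.closedBall (Real.ofDigits ω) r) := by
  -- a digit whose probability parameter is `0` vanishes
  have hzero : ∀ ω' : ℕ → Fin 2, (∀ j, bernoulliMeasure (1 : Fin 2) 0 (q j) {ω' j} ≠ 0) →
      ∀ j, q j = 0 → ω' j = 0 := by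
    intro ω' h j hj
    by_contra hne
    refine h j ?_
    rw [hj, bernoulliMeasure_zero, Measure.dirac_apply' _ (measurableSet_singleton _)]
    simp [Ne.symm hne]
  have hm2 : (0 : ℝ) < ((2 : ℝ) ^ (m + 2))⁻¹ := by positivity
  have hLm : ((2 : ℝ) ^ L)⁻¹ ≤ ((2 : ℝ) ^ (m + 2))⁻¹ := by
    gcongr; norm_num
  have hrδ : 2 * ((2 : ℝ) ^ L)⁻¹ < r ^ δ := by
    have e : 2 * ((2 : ℝ) ^ L)⁻¹ = (2 : ℝ) ^ (-((L : ℝ) - 1)) := by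
      rw [neg_sub, Real.rpow_sub two_pos, Real.rpow_one, Real.rpow_natCast]; rfl
    calc 2 * ((2 : ℝ) ^ L)⁻¹ < (2 : ℝ) ^ (-((m + 2) * δ)) := by
          rw [e]
          exact Real.rpow_lt_rpow_of_exponent_lt one_lt_two (by linarith)
      _ = (((2 : ℝ) ^ (m + 2))⁻¹) ^ δ := by
          rw [← neg_mul, Real.rpow_mul two_pos.le, Real.rpow_neg two_pos.le]
          norm_cast
      _ ≤ r ^ δ := by
          apply Real.rpow_le_rpow hm2.le _ hδ.le
          rw [hr]; simp
  -- the expansion of a point whose digits between `m + 1` and `L` vanish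
  have hexp : ∀ ω' : ℕ → Fin 2, (∀ j, bernoulliMeasure (1 : Fin 2) 0 (q j) {ω' j} ≠ 0) →
      ∃ t, 0 ≤ t ∧ t ≤ ((2 : ℝ) ^ L)⁻¹ ∧
        Real.ofDigits ω' = (2 * prefixNat ω' (m + 1) + (ω' (m + 1) : ℕ)) * ((2 : ℝ) ^ (m + 2))⁻¹ + t
        := by
    intro ω' h
    have hpre : ∀ i, m + 2 + i ≤ L → prefixNat ω' (m + 2 + i) = 2 ^ i * prefixNat ω' (m + 2) := by
      intro i
      induction i with
      | zero => simp
      | succ i ih =>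
        intro hi
        rw [← add_assoc, prefixNat, ih (by omega),
          hzero ω' h _ (hq' (m + 2 + i) (by omega) (by omega)), pow_succ]
        simp only [Fin.coe_ofNat_eq_mod, Nat.zero_mod]
        ring
    obtain ⟨i, rfl⟩ := Nat.exists_eq_add_of_le hmL
    refine ⟨Real.ofDigits (fun j => ω' (j + (m + 2 + i))) * ((2 : ℝ) ^ (m + 2 + i))⁻¹,
      mul_nonneg (Real.ofDigits_nonneg _) (by positivity),
      mul_le_of_le_one_left (by positivity) (Real.ofDigits_le_one _), ?_⟩
    rw [ofDigits_eq_prefixNat ω' (m + 2 + i), hpre i le_rfl,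
      show prefixNat ω' (m + 2) = 2 * prefixNat ω' (m + 1) + ω' (m + 1) from rfl, pow_add _ _ i]
    push_cast
    field
  have hae := ae_bitMeasure_singleton_ne_zero q
  obtain ⟨t, ht0, ht1, ht⟩ := hexp ω hω
  have hb : ∀ b : Fin 2, (0 : ℝ) ≤ (b : ℕ) ∧ ((b : ℕ) : ℝ) ≤ 1 := fun b =>
    ⟨by positivity, by exact_mod_cast Nat.le_of_lt_succ b.isLt⟩
  have hinner : digitMeasure q (Metric.closedBall (Real.ofDigits ω) (r - r ^ δ)) ≤
      bitMeasure q {ω' | ∀ j < m + 2, ω' j = ω j} := by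
    rw [digitMeasure_closedBall]
    refine measure_mono_ae ?_
    filter_upwards [hae] with ω' h' hball
    obtain ⟨t', ht0', ht1', ht'⟩ := hexp ω' h'
    change |Real.ofDigits ω' - Real.ofDigits ω| ≤ r - r ^ δ at hball
    have hP : ∀ ω' : ℕ → Fin 2, (∀ j, bernoulliMeasure (1 : Fin 2) 0 (q j) {ω' j} ≠ 0) →
        prefixNat ω' (m + 1) = 2 * prefixNat ω' m := by
      intro ω' h
      rw [prefixNat, hzero ω' h m hq]
      simp
    have hone : (((1 : Fin 2) : ℕ) : ℝ) = 1 := by norm_num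
    rw [ht, ht', hP ω hω, hP ω' h', h1, hone, abs_le] at hball
    set u := ((2 : ℝ) ^ (m + 2))⁻¹
    set P := prefixNat ω m with hPd
    set P' := prefixNat ω' m with hPd'
    set b' := ((ω' (m + 1) : Fin 2) : ℕ) with hb'
    push_cast at hball
    -- the integers `4 * P' + b'` and `4 * P + 1` differ by less than `1`, hence coincide
    have h2 : ((4 * P' + b' : ℤ) - (4 * P + 1) : ℝ) * u < 1 * u := by
      push_cast; linarith [hball.2]
    have h3 : (-1) * u < ((4 * P' + b' : ℤ) - (4 * P + 1) : ℝ) * u := by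
      push_cast; linarith [hball.1]
    have h2' := lt_of_mul_lt_mul_right h2 hm2.le
    have h3' := lt_of_mul_lt_mul_right h3 hm2.le
    have h4 : (4 * P' + b' : ℤ) - (4 * P + 1) < 1 := by exact_mod_cast h2'
    have h5 : -1 < (4 * P' + b' : ℤ) - (4 * P + 1) := by exact_mod_cast h3'
    have hlt := (ω' (m + 1)).isLt
    change ∀ j < m + 2, ω' j = ω j
    rw [← prefixNat_eq_iff]
    change 2 * prefixNat ω' (m + 1) + ω' (m + 1) = 2 * prefixNat ω (m + 1) + ω (m + 1)
    rw [hP ω hω, hP ω' h', h1]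
    simp only [Fin.coe_ofNat_eq_mod, Nat.one_mod]
    omega
  have houter : bitMeasure q {ω' | ∀ j < m + 1, ω' j = ω j} ≤
      digitMeasure q (Metric.closedBall (Real.ofDigits ω) r) := by
    rw [digitMeasure_closedBall]
    refine measure_mono_ae ?_
    filter_upwards [hae] with ω' h' hagree
    obtain ⟨t', ht0', ht1', ht'⟩ := hexp ω' h'
    change |Real.ofDigits ω' - Real.ofDigits ω| ≤ r
    rw [ht, ht', hr, prefixNat_eq_iff.2 hagree, abs_le]
    set u := ((2 : ℝ) ^ (m + 2))⁻¹
    have hx := hb (ω (m + 1))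
    have hx' := hb (ω' (m + 1))
    constructor <;> nlinarith
  refine hinner.trans ?_
  rw [bitMeasure_agree, Finset.prod_range_succ, ← bitMeasure_agree, mul_comm]
  gcongr
  rw [← ENNReal.ofReal_toReal (measure_ne_top _ {ω (m + 1)}), ← measureReal_def, h1]
  simp

/-! ### Positions of free and biased digits -/

/-- The digit positions `j` with `(2 n + 1)! ≤ j < (2 n + 2)!` for some `n`. -/
def highScales : Set ℕ := {j | ∃ n : ℕ, (2 * n + 1)! ≤ j ∧ j < (2 * n + 2)!}

/-- The positions `(2 n + 2)! + 1` of the biased digits. -/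
def biasedScales : Set ℕ := Set.range fun n : ℕ => (2 * n + 2)! + 1

/-- Intervals between consecutive factorials are disjoint. -/
lemma eq_of_factorial_le_of_lt {a b j : ℕ} (ha : a ! ≤ j) (ha' : j < (a + 1)!)
    (hb : b ! ≤ j) (hb' : j < (b + 1)!) : a = b := by
  by_contra hne
  rcases Nat.lt_or_gt_of_ne hne with h | h
  · have := Nat.factorial_le (show a + 1 ≤ b from h)
    omega
  · have := Nat.factorial_le (show b + 1 ≤ a from h)
    omega

lemma notMem_highScales {n j : ℕ} (h : (2 * n)! ≤ j) (h' : j < (2 * n + 1)!) :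
    j ∉ highScales := by
  rintro ⟨m, hm, hm'⟩
  have := eq_of_factorial_le_of_lt h h' hm hm'
  omega

lemma two_mul_add_three_le_factorial (n : ℕ) : (2 * n + 2)! + 3 ≤ (2 * n + 3)! := by
  have h : 2 ≤ (2 * n + 2)! := by
    simpa using Nat.factorial_le (show 2 ≤ 2 * n + 2 by omega)
  rw [Nat.factorial_succ (2 * n + 2)]
  nlinarith

lemma notMem_biasedScales {n j : ℕ} (h : (2 * n + 2)! ≤ j) (h' : j < (2 * n + 3)!)
    (hne : j ≠ (2 * n + 2)! + 1) : j ∉ biasedScales := by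
  rintro ⟨m, rfl⟩
  have h3 := two_mul_add_three_le_factorial m
  have := eq_of_factorial_le_of_lt h h' (b := 2 * m + 2) (Nat.le_succ _)
    (show (2 * m + 2)! + 1 < (2 * m + 3)! by omega)
  obtain rfl : n = m := by omega
  exact hne rfl

lemma frequently_of_factorial {p : ℕ → Prop} {a : ℕ → ℕ} (ha : ∀ n, n ≤ a n)
    (h : ∀ᶠ n : ℕ in atTop, p (a n)!) : ∃ᶠ k in atTop, p k := by
  have ht : Tendsto (fun n : ℕ => (a n)!) atTop atTop :=
    tendsto_atTop_mono (fun n => (ha n).trans (Nat.self_le_factorial _)) tendsto_id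
  exact ht.frequently h.frequently

/-- At the scale `(2 n + 1)!`, a proportion at most `1 / (2 n + 1)` of the positions is high. -/
lemma frequently_count_highScales_le {ε : ℝ} (hε : 0 < ε) :
    ∃ᶠ k in atTop, (Nat.count (· ∈ highScales) k : ℝ) ≤ ε * k := by
  refine frequently_of_factorial (a := fun n => 2 * n + 1) (fun n => by omega) ?_
  have hc : ∀ n : ℕ, Nat.count (· ∈ highScales) (2 * n + 1)! ≤ (2 * n)! := by
    intro n
    obtain ⟨i, hi⟩ := Nat.exists_eq_add_of_le (Nat.factorial_le (show 2 * n ≤ 2 * n + 1 by omega))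
    rw [hi, Nat.count_add, Nat.count_of_forall_not (n := i), add_zero]
    · exact Nat.count_le _
    · intro j hj
      exact notMem_highScales (n := n) (by omega) (by omega)
  filter_upwards [tendsto_natCast_atTop_atTop.eventually_ge_atTop ε⁻¹] with n hn
  calc (Nat.count (· ∈ highScales) (2 * n + 1)! : ℝ) ≤ (2 * n)! := by exact_mod_cast hc n
    _ ≤ ε * (2 * n + 1 : ℕ) * (2 * n)! := by
      refine le_mul_of_one_le_left (by positivity) ?_
      have h1 : ε * ε⁻¹ ≤ ε * n := by gcongr
      rw [mul_inv_cancel₀ hε.ne'] at h1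
      have h2 : ε * n ≤ ε * (2 * n + 1 : ℕ) := by
        gcongr; omega
      linarith
    _ = ε * (2 * n + 1)! := by rw [Nat.factorial_succ]; push_cast; ring

/-- At the scale `(2 n + 2)!`, a proportion at least `1 - 1 / (2 n + 2)` of the positions is
high. -/
lemma frequently_le_count_highScales {ε : ℝ} (hε : 0 < ε) :
    ∃ᶠ k in atTop, (1 - ε) * k ≤ (Nat.count (· ∈ highScales) k : ℝ) := by
  refine frequently_of_factorial (a := fun n => 2 * n + 2) (fun n => by omega) ?_
  have hc : ∀ n : ℕ, (2 * n + 2)! ≤ Nat.count (· ∈ highScales) (2 * n + 2)! + (2 * n + 1)! := by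
    intro n
    obtain ⟨i, hi⟩ := Nat.exists_eq_add_of_le
      (Nat.factorial_le (show 2 * n + 1 ≤ 2 * n + 2 by omega))
    have : Nat.count (fun j => (2 * n + 1)! + j ∈ highScales) i = i := by
      rw [Nat.count_iff_forall]
      intro j hj
      exact ⟨n, by omega, by omega⟩
    have h2 : Nat.count (· ∈ highScales) (2 * n + 2)! =
        Nat.count (· ∈ highScales) (2 * n + 1)! + i := by
      rw [hi, Nat.count_add, this]
    omega
  filter_upwards [tendsto_natCast_atTop_atTop.eventually_ge_atTop ε⁻¹] with n hn
  have h1 : ((2 * n + 1)! : ℝ) ≤ ε * (2 * n + 2)! := by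
    calc ((2 * n + 1)! : ℝ) ≤ ε * (2 * n + 2 : ℕ) * (2 * n + 1)! := by
          refine le_mul_of_one_le_left (by positivity) ?_
          have h1 : ε * ε⁻¹ ≤ ε * n := by gcongr
          rw [mul_inv_cancel₀ hε.ne'] at h1
          have h2 : ε * n ≤ ε * (2 * n + 2 : ℕ) := by
            gcongr; omega
          linarith
      _ = ε * (2 * n + 2)! := by rw [Nat.factorial_succ (2 * n + 1)]; push_cast; ring
  have h2 : ((2 * n + 2)! : ℝ) ≤ Nat.count (· ∈ highScales) (2 * n + 2)! + (2 * n + 1)! := by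
    exact_mod_cast hc n
  change (1 - ε) * ((2 * n + 2)! : ℝ) ≤ Nat.count (· ∈ highScales) (2 * n + 2)!
  linarith

/-- The `n`-th biased position, counted from `0`, exceeds `(n + 1) ^ 2`. -/
lemma count_biasedScales_le_sqrt (k : ℕ) : Nat.count (· ∈ biasedScales) k ≤ Nat.sqrt k := by
  rw [Nat.count_eq_card_filter_range]
  calc _ ≤ ((Finset.range (Nat.sqrt k)).image fun n : ℕ => (2 * n + 2)! + 1).card := by
        refine Finset.card_le_card fun j hj => ?_
        simp only [Finset.mem_filter, Finset.mem_range] at hj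
        obtain ⟨hjk, n, rfl⟩ := hj
        refine Finset.mem_image_of_mem _ (Finset.mem_range.2 ?_)
        rw [← Nat.succ_le_iff, Nat.le_sqrt]
        have : (2 * n + 2) * (2 * n + 1) ≤ (2 * n + 2)! := by
          rw [Nat.factorial_succ, Nat.factorial_succ, ← mul_assoc]
          exact Nat.le_mul_of_pos_right _ (Nat.factorial_pos _)
        nlinarith
    _ ≤ _ := Finset.card_image_le.trans (by simp)

lemma eventually_count_biasedScales_le {ε : ℝ} (hε : 0 < ε) :
    ∀ᶠ k : ℕ in atTop, (Nat.count (· ∈ biasedScales) k : ℝ) ≤ ε * k := by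
  have ht : Tendsto (fun k : ℕ => √(k : ℝ)) atTop atTop :=
    Real.tendsto_sqrt_atTop.comp tendsto_natCast_atTop_atTop
  filter_upwards [ht.eventually_ge_atTop ε⁻¹] with k hk
  have h1 : (Nat.count (· ∈ biasedScales) k : ℝ) ≤ √(k : ℝ) :=
    (Nat.cast_le.2 (count_biasedScales_le_sqrt k)).trans Real.nat_sqrt_le_real_sqrt
  have h2 : ε * ε⁻¹ ≤ ε * √(k : ℝ) := by gcongr
  rw [mul_inv_cancel₀ hε.ne'] at h2
  calc _ ≤ √(k : ℝ) := h1
    _ ≤ ε * √(k : ℝ) * √(k : ℝ) := le_mul_of_one_le_left (by positivity) h2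
    _ = ε * k := by rw [mul_assoc, Real.mul_self_sqrt (by positivity)]

/-- The accumulated rate at position `k`, where a high position contributes `b` and any other
position contributes `a`. -/
def cumulRate (a b : ℝ) (k : ℕ) : ℝ := a * k + (b - a) * Nat.count (· ∈ highScales) k

lemma cumulRate_succ (a b : ℝ) (k : ℕ) :
    cumulRate a b (k + 1) = cumulRate a b k + if k ∈ highScales then b else a := by
  rw [cumulRate, cumulRate, Nat.count_succ]
  split_ifs <;> push_cast <;> ring

/-- The positions at which the integer part of the accumulated rate increases. -/
def freeScales (a b : ℝ) : Set ℕ := {j | ⌊cumulRate a b (j + 1)⌋₊ = ⌊cumulRate a b j⌋₊ + 1}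

lemma cumulRate_nonneg {a b : ℝ} (ha : 0 ≤ a) (hb : 0 ≤ b) (k : ℕ) : 0 ≤ cumulRate a b k := by
  induction k with
  | zero => simp [cumulRate]
  | succ k ih => rw [cumulRate_succ]; split_ifs <;> positivity

/-- For rates in `[0, 1]`, each step increases the integer part by `0` or `1`. -/
lemma count_freeScales {a b : ℝ} (ha : 0 ≤ a) (ha1 : a ≤ 1) (hb : 0 ≤ b) (hb1 : b ≤ 1) (k : ℕ) :
    Nat.count (· ∈ freeScales a b) k = ⌊cumulRate a b k⌋₊ := by
  induction k with
  | zero => simp [cumulRate]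
  | succ k ih =>
    have h0 := cumulRate_nonneg ha hb k
    have h1 : ⌊cumulRate a b k⌋₊ ≤ ⌊cumulRate a b (k + 1)⌋₊ := by
      apply Nat.floor_le_floor
      rw [cumulRate_succ]; split_ifs <;> linarith
    have h2 : ⌊cumulRate a b (k + 1)⌋₊ ≤ ⌊cumulRate a b k⌋₊ + 1 := by
      rw [← Nat.floor_add_one h0]
      apply Nat.floor_le_floor
      rw [cumulRate_succ]; split_ifs <;> linarith
    rw [Nat.count_succ, ih]
    by_cases hk : k ∈ freeScales a b
    · rw [if_pos hk]
      exact hk.symm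
    · rw [if_neg hk]
      have hk' : ⌊cumulRate a b (k + 1)⌋₊ ≠ ⌊cumulRate a b k⌋₊ + 1 := hk
      omega

lemma notMem_freeScales_zero {b : ℝ} {j : ℕ} (hj : j ∉ highScales) : j ∉ freeScales 0 b := by
  simp [freeScales, cumulRate_succ, hj]

/-! ### Masses of dyadic balls and dimensions -/

lemma inv_two_pow_rpow (k : ℕ) (a : ℝ) : (((2 : ℝ) ^ k)⁻¹) ^ a = (2 : ℝ) ^ (-(a * k)) := by
  rw [← Real.rpow_natCast, ← Real.rpow_neg two_pos.le, ← Real.rpow_mul two_pos.le]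
  ring_nf

/-- A radius smaller than `2 ^ (-K)` lies between consecutive powers `2 ^ (-k - 1)` and `2 ^ (-k)`
with `K ≤ k`. -/
lemma exists_dyadic_scale {K : ℕ} {r : ℝ} (hr : 0 < r) (hrK : r < ((2 : ℝ) ^ K)⁻¹) :
    ∃ k, K ≤ k ∧ ((2 : ℝ) ^ (k + 1))⁻¹ < r ∧ r ≤ ((2 : ℝ) ^ k)⁻¹ := by
  have h1 : r ≤ 1 := hrK.le.trans (inv_le_one_of_one_le₀ (one_le_pow₀ one_le_two))
  obtain ⟨k, hk, hk'⟩ := exists_nat_pow_near_of_lt_one hr h1 (y := (2 : ℝ)⁻¹) (by norm_num)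
    (by norm_num)
  rw [inv_pow] at hk hk'
  refine ⟨k, ?_, hk, hk'⟩
  have := hk.trans hrK
  rw [inv_lt_inv₀ (by positivity) (by positivity), pow_lt_pow_iff_right₀ one_lt_two] at this
  omega

lemma eventually_inv_two_pow_lt {ρ : ℝ} (hρ : 0 < ρ) : ∀ᶠ k : ℕ in atTop, ((2 : ℝ) ^ k)⁻¹ < ρ :=
  (tendsto_inv_atTop_zero.comp (tendsto_pow_atTop_atTop_of_one_lt one_lt_two)).eventually_lt_const
    hρ

lemma exponent_le_of_ofReal_le {k : ℕ} {a b : ℝ}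
    (h : ENNReal.ofReal ((2 : ℝ) ^ (-a)) ≤ ENNReal.ofReal (((2 : ℝ) ^ k)⁻¹ ^ b)) : b * k ≤ a := by
  rw [inv_two_pow_rpow, ENNReal.ofReal_le_ofReal_iff (by positivity),
    Real.rpow_le_rpow_left_iff one_lt_two] at h
  linarith

lemma exponent_le_of_ofReal_le' {k : ℕ} {a b : ℝ}
    (h : ENNReal.ofReal (((2 : ℝ) ^ k)⁻¹ ^ b) ≤ ENNReal.ofReal ((2 : ℝ) ^ (-a))) : a ≤ b * k := by
  rw [inv_two_pow_rpow, ENNReal.ofReal_le_ofReal_iff (by positivity),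
    Real.rpow_le_rpow_left_iff one_lt_two] at h
  linarith

section Dyadic

variable {d : ℕ} {μ : Measure (Fin d → ℝ)} [IsProbabilityMeasure μ] {D : ℝ} {f g : ℕ → ℝ}

/-- If almost every ball of radius `2 ^ (-k)` has mass between `2 ^ (-f k)` and `2 ^ (-g k)`, where
`liminf g k / k ≥ D` and `liminf f k / k ≤ D`, then the lower dimension is `D`. -/
lemma lowerDim_eq_of_dyadic
    (hle : ∀ᵐ x ∂μ, ∀ k : ℕ,
      μ (Metric.closedBall x ((2 : ℝ) ^ k)⁻¹) ≤ ENNReal.ofReal ((2 : ℝ) ^ (-g k)))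
    (hge : ∀ᵐ x ∂μ, ∀ k : ℕ,
      ENNReal.ofReal ((2 : ℝ) ^ (-f k)) ≤ μ (Metric.closedBall x ((2 : ℝ) ^ k)⁻¹))
    (hg : ∀ ε : ℝ, 0 < ε → ∀ᶠ k : ℕ in atTop, (D - ε) * k ≤ g k)
    (hf : ∀ ε : ℝ, 0 < ε → ∃ᶠ k : ℕ in atTop, f k ≤ (D + ε) * k) :
    lowerDim μ = (D : EReal) := by
  apply le_antisymm
  · apply sSup_le
    rintro _ ⟨α, ⟨hα0, hα⟩, rfl⟩
    rw [EReal.coe_le_coe_iff]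
    by_contra! hlt
    obtain ⟨x, hx, ρ, hρ, hxρ⟩ := (hge.and hα).exists
    obtain ⟨k, hk, hk', hk0⟩ := ((hf ((α - D) / 2) (by linarith)).and_eventually
      ((eventually_inv_two_pow_lt hρ).and (eventually_gt_atTop 0))).exists
    have h := exponent_le_of_ofReal_le ((hx k).trans (hxρ _ (by positivity) hk'))
    have hk0' : (0 : ℝ) < k := by exact_mod_cast hk0
    nlinarith
  · by_contra! hlt
    obtain ⟨α, hα1, hα2⟩ := EReal.lt_iff_exists_real_btwn.1 hlt
    rw [EReal.coe_lt_coe_iff] at hα2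
    refine absurd hα1 (not_lt.2 ?_)
    -- `α` may be negative, and only nonnegative exponents compete in the supremum
    refine (EReal.coe_le_coe_iff.2 (le_max_left α 0)).trans
      (le_sSup ⟨_, ⟨le_max_right _ _, ?_⟩, rfl⟩)
    rcases le_or_gt α 0 with h0 | h0
    · rw [max_eq_right h0]
      refine .of_forall fun x => ⟨1, one_pos, fun r _ _ => ?_⟩
      simpa using prob_le_one
    · rw [max_eq_left h0.le]
      obtain ⟨K, hK⟩ := eventually_atTop.1 (((hg ((D - α) / 2) (by linarith)).and
        ((tendsto_natCast_atTop_atTop (R := ℝ)).eventually_ge_atTop (α / ((D - α) / 2)))))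
      filter_upwards [hle] with x hx
      refine ⟨((2 : ℝ) ^ K)⁻¹, by positivity, fun r hr hrK => ?_⟩
      obtain ⟨k, hKk, hk, hk'⟩ := exists_dyadic_scale hr hrK
      obtain ⟨h1, h2⟩ := hK k hKk
      rw [div_le_iff₀ (by linarith)] at h2
      calc μ (Metric.closedBall x r) ≤ _ := measure_mono (Metric.closedBall_subset_closedBall hk')
        _ ≤ _ := hx k
        _ ≤ ENNReal.ofReal (((2 : ℝ) ^ (k + 1))⁻¹ ^ α) := by
          apply ENNReal.ofReal_le_ofReal
          rw [inv_two_pow_rpow]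
          apply Real.rpow_le_rpow_of_exponent_le one_le_two
          push_cast
          linarith
        _ ≤ _ := by gcongr

/-- If almost every ball of radius `2 ^ (-k)` has mass between `2 ^ (-f k)` and `2 ^ (-g k)`, where
`limsup f k / k ≤ D` and `limsup g k / k ≥ D`, then the upper dimension is `D`. -/
lemma upperDim_eq_of_dyadic (hD : 0 ≤ D)
    (hle : ∀ᵐ x ∂μ, ∀ k : ℕ,
      μ (Metric.closedBall x ((2 : ℝ) ^ k)⁻¹) ≤ ENNReal.ofReal ((2 : ℝ) ^ (-g k)))
    (hge : ∀ᵐ x ∂μ, ∀ k : ℕ,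
      ENNReal.ofReal ((2 : ℝ) ^ (-f k)) ≤ μ (Metric.closedBall x ((2 : ℝ) ^ k)⁻¹))
    (hf : ∀ ε : ℝ, 0 < ε → ∀ᶠ k : ℕ in atTop, f k ≤ (D + ε) * k)
    (hg : ∀ ε : ℝ, 0 < ε → ∃ᶠ k : ℕ in atTop, (D - ε) * k ≤ g k) :
    upperDim μ = (D : EReal) := by
  apply le_antisymm
  · by_contra! hlt
    obtain ⟨β, hβ1, hβ2⟩ := EReal.lt_iff_exists_real_btwn.1 hlt
    rw [EReal.coe_lt_coe_iff] at hβ1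
    refine absurd hβ2 (not_lt.2 (sInf_le ⟨_, ⟨by linarith, ?_⟩, rfl⟩))
    obtain ⟨K, hK⟩ := eventually_atTop.1 (((hf ((β - D) / 2) (by linarith)).and
      ((tendsto_natCast_atTop_atTop (R := ℝ)).eventually_ge_atTop (β / ((β - D) / 2)))))
    filter_upwards [hge] with x hx
    refine ⟨((2 : ℝ) ^ K)⁻¹, by positivity, fun r hr hrK => ?_⟩
    obtain ⟨k, hKk, hk, hk'⟩ := exists_dyadic_scale hr hrK
    obtain ⟨h1, h2⟩ := hK (k + 1) (by omega)
    rw [div_le_iff₀ (by linarith)] at h2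
    calc ENNReal.ofReal (r ^ β) ≤ ENNReal.ofReal (((2 : ℝ) ^ k)⁻¹ ^ β) := by gcongr; linarith
      _ ≤ ENNReal.ofReal ((2 : ℝ) ^ (-f (k + 1))) := by
        apply ENNReal.ofReal_le_ofReal
        rw [inv_two_pow_rpow]
        apply Real.rpow_le_rpow_of_exponent_le one_le_two
        push_cast at h1 h2
        linarith
      _ ≤ _ := hx (k + 1)
      _ ≤ _ := measure_mono (Metric.closedBall_subset_closedBall hk.le)
  · apply le_sInf
    rintro _ ⟨β, ⟨hβ0, hβ⟩, rfl⟩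
    rw [EReal.coe_le_coe_iff]
    by_contra! hlt
    obtain ⟨x, hx, ρ, hρ, hxρ⟩ := (hle.and hβ).exists
    obtain ⟨k, hk, hk', hk0⟩ := ((hg ((D - β) / 2) (by linarith)).and_eventually
      ((eventually_inv_two_pow_lt hρ).and (eventually_gt_atTop 0))).exists
    have h := exponent_le_of_ofReal_le' ((hxρ _ (by positivity) hk').trans (hx k))
    have hk0' : (0 : ℝ) < k := by exact_mod_cast hk0
    nlinarith

/-- A point surrounded by arbitrarily small charged annuli, which do not contain it, is not an
atom. -/
lemma measure_singleton_of_mem_thinAnnuliSet {δ η : ℝ} (hδ : 1 ≤ δ) (hη : 0 < η) {x : Fin d → ℝ}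
    (hx : x ∈ thinAnnuliSet μ δ η) : μ {x} = 0 := by
  obtain ⟨r, hr, hr0, hA⟩ := hx
  have ht : Tendsto (fun n => μ (Metric.closedBall x (r n))) atTop (𝓝 (μ {x})) := by
    have h := (tendsto_measure_cthickening_of_isClosed (μ := μ) (s := {x})
      ⟨1, one_pos, measure_ne_top _ _⟩ isClosed_singleton).comp hr0
    refine h.congr fun n => ?_
    simp only [Function.comp_apply]
    rw [Metric.cthickening_singleton _ (hr n).1.le]
  have hle : ∀ n, ENNReal.ofReal η * μ {x} + μ {x} ≤ μ (Metric.closedBall x (r n)) := by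
    intro n
    have hx1 : x ∈ Metric.closedBall x (r n - r n ^ δ) := by
      apply Metric.mem_closedBall_self
      have := Real.rpow_le_rpow_of_exponent_ge (hr n).1 (hr n).2.le hδ
      rw [Real.rpow_one] at this
      linarith
    have hx2 : x ∈ Metric.closedBall x (r n) := Metric.mem_closedBall_self (hr n).1.le
    calc _ ≤ ENNReal.ofReal η * μ (Metric.closedBall x (r n)) + μ {x} := by
          gcongr; simpa using hx2
      _ ≤ μ (annulus x (r n) δ) + μ {x} := by gcongr; exact hA n
      _ = μ (annulus x (r n) δ ∪ {x}) := by
          rw [measure_union _ (measurableSet_singleton _)]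
          rw [Set.disjoint_singleton_right]
          exact fun h => h.2 hx1
      _ ≤ _ := by
          refine measure_mono (Set.union_subset Set.sdiff_subset ?_)
          simpa using hx2
  have h := ge_of_tendsto' ht hle
  by_contra h0
  have hpos : 0 < ENNReal.ofReal η * μ {x} :=
    ENNReal.mul_pos (ENNReal.ofReal_pos.2 hη).ne' h0
  have := ENNReal.lt_add_right (measure_ne_top μ {x}) hpos.ne'
  rw [add_comm] at this
  exact absurd h (not_le.2 this)

end Dyadic

/-! ### Masses of intervals for free, biased and fixed digits -/

/-- The probability `2 ^ (-c)`. -/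
def twoPowNeg (c : ℕ) : I :=
  ⟨((2 : ℝ) ^ c)⁻¹, by positivity, inv_le_one_of_one_le₀ (one_le_pow₀ one_le_two)⟩

/-- The digit probabilities for which a position in `F` carries a fair digit, a position in
`S \ F` carries a digit equal to `1` with probability `2 ^ (-c)`, and any other position carries
the digit `0`. -/
def digitProb (c : ℕ) (F S : Set ℕ) (j : ℕ) : I :=
  if j ∈ F then twoPowNeg 1 else if j ∈ S then twoPowNeg c else 0

lemma coe_twoPowNeg_le_half {c : ℕ} (hc : 1 ≤ c) : (twoPowNeg c : ℝ) ≤ 1 / 2 := by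
  rw [one_div]
  refine inv_anti₀ two_pos ?_
  simpa using pow_le_pow_right₀ (one_le_two (α := ℝ)) hc

lemma digitProb_le_half {c : ℕ} (hc : 1 ≤ c) (F S : Set ℕ) (j : ℕ) :
    (digitProb c F S j : ℝ) ≤ 1 / 2 := by
  unfold digitProb
  split_ifs
  · exact coe_twoPowNeg_le_half le_rfl
  · exact coe_twoPowNeg_le_half hc
  · norm_num

lemma ofReal_two_rpow_add (a b : ℝ) : ENNReal.ofReal ((2 : ℝ) ^ (a + b)) =
    ENNReal.ofReal ((2 : ℝ) ^ a) * ENNReal.ofReal ((2 : ℝ) ^ b) := by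
  rw [Real.rpow_add two_pos, ENNReal.ofReal_mul (by positivity)]

lemma ofReal_two_rpow_sum {ι : Type*} (s : Finset ι) (a : ι → ℝ) :
    ENNReal.ofReal ((2 : ℝ) ^ ∑ i ∈ s, a i) = ∏ i ∈ s, ENNReal.ofReal ((2 : ℝ) ^ a i) := by
  rw [← ENNReal.ofReal_prod_of_nonneg (fun i _ => by positivity), Real.rpow_sum_of_pos two_pos]

lemma digitMeasure_digitProb_closedBall_le {c : ℕ} (hc : 1 ≤ c) (F S : Set ℕ) (x : ℝ) (k : ℕ) :
    digitMeasure (digitProb c F S) (Metric.closedBall x ((2 : ℝ) ^ k)⁻¹) ≤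
      ENNReal.ofReal ((2 : ℝ) ^ (2 - (Nat.count (· ∈ F) k : ℝ))) := by
  refine (digitMeasure_closedBall_le (digitProb_le_half hc F S) x k).trans ?_
  have h : ∏ j ∈ Finset.range k, ENNReal.ofReal (1 - digitProb c F S j) ≤
      ENNReal.ofReal ((2 : ℝ) ^ (-(Nat.count (· ∈ F) k : ℝ))) := by
    induction k with
    | zero => simp
    | succ k ih =>
      rw [Finset.prod_range_succ, Nat.count_succ]
      push_cast
      rw [neg_add, ofReal_two_rpow_add]
      gcongr
      by_cases hk : k ∈ F
      · rw [if_pos hk, digitProb, if_pos hk, Real.rpow_neg_one, twoPowNeg]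
        norm_num
      · rw [if_neg hk, neg_zero, Real.rpow_zero]
        linarith [(digitProb c F S k).2.1]
  rw [sub_eq_add_neg, ofReal_two_rpow_add]
  gcongr
  norm_num

/-- A possible value of a digit has probability at least `2 ^ (-1)` at a free position, `2 ^ (-c)`
at a biased one, and `1` elsewhere. At a free position that also lies in `S` the stated bound is
smaller than needed. -/
lemma le_bernoulli_digitProb {c : ℕ} (hc : 1 ≤ c) (F S : Set ℕ) (j : ℕ) (b : Fin 2)
    (hb : bernoulliMeasure (1 : Fin 2) 0 (digitProb c F S j) {b} ≠ 0) :
    ENNReal.ofReal ((2 : ℝ) ^ (-((if j ∈ F then 1 else 0 : ℕ) + c * (if j ∈ S then 1 else 0 : ℕ)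
      : ℝ))) ≤ bernoulliMeasure (1 : Fin 2) 0 (digitProb c F S j) {b} := by
  have key : ∀ a : ℕ, 1 ≤ a → ENNReal.ofReal ((2 : ℝ) ^ (-(a : ℝ))) ≤
      bernoulliMeasure (1 : Fin 2) 0 (twoPowNeg a) {b} := by
    intro a ha
    have h2 := coe_twoPowNeg_le_half ha
    have h3 : (2 : ℝ) ^ (-(a : ℝ)) = twoPowNeg a := by
      rw [Real.rpow_neg two_pos.le, Real.rpow_natCast]; rfl
    rw [← ENNReal.ofReal_toReal (measure_ne_top (bernoulliMeasure _ _ _) {b}), ← measureReal_def,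
      h3]
    apply ENNReal.ofReal_le_ofReal
    fin_cases b
    · simp; linarith
    · simp
  unfold digitProb at hb ⊢
  by_cases hF : j ∈ F
  · simp only [hF, if_true]
    refine le_trans ?_ (key 1 le_rfl)
    apply ENNReal.ofReal_le_ofReal
    apply Real.rpow_le_rpow_of_exponent_le one_le_two
    simp only [Nat.cast_one, neg_add_rev, add_le_iff_nonpos_left, Left.neg_nonpos_iff]
    positivity
  · by_cases hS : j ∈ S
    · simpa [hF, hS] using key c hc
    · simp only [hF, hS, if_false, bernoulliMeasure_zero] at hb ⊢
      rw [Measure.dirac_apply' _ (measurableSet_singleton _)] at hb ⊢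
      have h0 : (0 : Fin 2) ∈ ({b} : Set (Fin 2)) := by
        by_contra h
        exact hb (by simp [h])
      rw [Set.indicator_of_mem h0]
      simp

lemma ae_le_digitMeasure_digitProb_closedBall {c : ℕ} (hc : 1 ≤ c) (F S : Set ℕ) :
    ∀ᵐ x ∂digitMeasure (digitProb c F S), ∀ k : ℕ,
      ENNReal.ofReal ((2 : ℝ) ^ (-(Nat.count (· ∈ F) k + c * Nat.count (· ∈ S) k : ℝ))) ≤
        digitMeasure (digitProb c F S) (Metric.closedBall x ((2 : ℝ) ^ k)⁻¹) := by
  apply ae_digitMeasure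
  filter_upwards [ae_bitMeasure_singleton_ne_zero (digitProb c F S)] with ω hω k
  refine le_trans ?_ (le_digitMeasure_closedBall _ ω k)
  induction k with
  | zero => simp
  | succ k ih =>
    rw [Finset.prod_range_succ, Nat.count_succ, Nat.count_succ]
    calc _ = ENNReal.ofReal ((2 : ℝ) ^ (-(Nat.count (· ∈ F) k + c * Nat.count (· ∈ S) k : ℝ))) *
          ENNReal.ofReal ((2 : ℝ) ^ (-((if k ∈ F then 1 else 0 : ℕ) +
            c * (if k ∈ S then 1 else 0 : ℕ) : ℝ))) := by
          rw [← ofReal_two_rpow_add]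
          congr 2
          push_cast
          ring
      _ ≤ _ := by
          gcongr
          exact le_bernoulli_digitProb hc F S k _ (hω k)

/-! ### Thin annuli for one coordinate -/

/-- The ratio of `(2 n + 3)!` to `(2 n + 2)!` eventually exceeds `δ` by enough for the annulus
estimate at the position `(2 n + 2)! + 1`. -/
lemma eventually_inner_scale (δ : ℝ) :
    ∀ᶠ n : ℕ in atTop, (((2 * n + 2)! : ℕ) + 2 : ℝ) * δ < ((2 * n + 3)! : ℕ) - 1 := by
  filter_upwards [tendsto_natCast_atTop_atTop.eventually_gt_atTop (2 * |δ| + 1)] with n hn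
  have h2 : (2 : ℝ) ≤ ((2 * n + 2)! : ℕ) := by
    exact_mod_cast Nat.factorial_le (show 2 ≤ 2 * n + 2 by omega)
  have h3 : (((2 * n + 3)! : ℕ) : ℝ) = (2 * n + 3) * ((2 * n + 2)! : ℕ) := by
    rw [Nat.factorial_succ]; push_cast; ring
  rw [h3]
  set u := (((2 * n + 2)! : ℕ) : ℝ)
  have := le_abs_self δ
  have := abs_nonneg δ
  calc (u + 2) * δ ≤ (u + 2) * |δ| := by gcongr
    _ ≤ (2 * u) * |δ| := by gcongr; linarith
    _ < (2 * n + 3) * u - 1 := by nlinarith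

/-- With biased digits at the positions `(2 n + 2)! + 1`, and fair digits only at high positions,
almost every point has arbitrarily small radii `r` such that the ball of radius `r - r ^ δ` has at
most the proportion `2 ^ (-c)` of the mass of the ball of radius `r`. -/
lemma ae_exists_inner_ball {c : ℕ} (b : ℝ) {δ : ℝ} (hδ : 0 < δ) :
    ∀ᵐ x ∂digitMeasure (digitProb c (freeScales 0 b) biasedScales), ∀ ε : ℝ, 0 < ε →
      ∃ r : ℝ, 0 < r ∧ r < ε ∧
        digitMeasure (digitProb c (freeScales 0 b) biasedScales)
            (Metric.closedBall x (r - r ^ δ)) ≤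
          ENNReal.ofReal (((2 : ℝ) ^ c)⁻¹) *
            digitMeasure (digitProb c (freeScales 0 b) biasedScales) (Metric.closedBall x r) := by
  apply ae_digitMeasure
  set q := digitProb c (freeScales 0 b) biasedScales with hqd
  have hlow : ∀ n j : ℕ, (2 * n + 2)! ≤ j → j < (2 * n + 3)! → j ∉ freeScales 0 b :=
    fun n j h h' => notMem_freeScales_zero (notMem_highScales (n := n + 1) h h')
  have hq0 : ∀ n j : ℕ, (2 * n + 2)! ≤ j → j < (2 * n + 3)! → j ≠ (2 * n + 2)! + 1 → q j = 0 := by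
    intro n j h h' hne
    rw [hqd, digitProb, if_neg (hlow n j h h'), if_neg (notMem_biasedScales h h' hne)]
  have hq1 : ∀ n : ℕ, q ((2 * n + 2)! + 1) = twoPowNeg c := by
    intro n
    have := two_mul_add_three_le_factorial n
    rw [hqd, digitProb, if_neg (hlow n _ (by omega) (by omega)), if_pos ⟨n, rfl⟩]
  have hinj : Function.Injective fun n : ℕ => (2 * n + 2)! + 1 := by
    intro n m h
    have h' : (2 * n + 2)! = (2 * m + 2)! := by simpa using h
    have := (Nat.factorial_inj (n := 2 * n + 2) (m := 2 * m + 2) (by omega)).1 h'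
    omega
  have hpos : (0 : I) < twoPowNeg c := by
    change (0 : ℝ) < ((2 : ℝ) ^ c)⁻¹
    positivity
  filter_upwards [ae_bitMeasure_singleton_ne_zero q, ae_frequently_eq_one hinj hpos hq1]
    with ω hω hfreq ε hε
  have hn : Tendsto (fun n : ℕ => (2 * n + 2)!) atTop atTop :=
    tendsto_atTop_mono (fun n => (show n ≤ 2 * n + 2 by omega).trans (Nat.self_le_factorial _))
      tendsto_id
  obtain ⟨n, hn1, hnδ, hnε⟩ := (hfreq.and_eventually ((eventually_inner_scale δ).and
    (hn.eventually (eventually_inv_two_pow_lt hε)))).exists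
  have h3 := two_mul_add_three_le_factorial n
  refine ⟨((2 : ℝ) ^ ((2 * n + 2)! + 2))⁻¹ + ((2 : ℝ) ^ (2 * n + 3)!)⁻¹, by positivity, ?_, ?_⟩
  · refine lt_of_le_of_lt ?_ hnε
    have h4 : ((2 : ℝ) ^ (2 * n + 3)!)⁻¹ ≤ ((2 : ℝ) ^ ((2 * n + 2)! + 2))⁻¹ := by
      gcongr
      · norm_num
      · omega
    have h5 : ((2 : ℝ) ^ ((2 * n + 2)! + 2))⁻¹ = ((2 : ℝ) ^ (2 * n + 2)!)⁻¹ / 4 := by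
      rw [pow_add]; field
    have h6 : 0 < ((2 : ℝ) ^ (2 * n + 2)!)⁻¹ := by positivity
    linarith
  · have h := digitMeasure_inner_ball_le (q := q) (L := (2 * n + 3)!) hδ hω hn1
      (hq0 n _ le_rfl (by omega) (by omega))
      (fun j hj hj' => hq0 n j (by omega) hj' (by omega)) hnδ (by omega) rfl
    rwa [hq1 n] at h

/-! ### The product measure -/

lemma pi_closedBall {ι : Type*} [Fintype ι] (ν : ι → Measure ℝ) [∀ i, SigmaFinite (ν i)]
    (x : ι → ℝ) {r : ℝ} (hr : 0 ≤ r) :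
    Measure.pi ν (Metric.closedBall x r) = ∏ i, ν i (Metric.closedBall (x i) r) := by
  rw [closedBall_pi x hr, Measure.pi_pi]

/-- Balls for the maximum norm are cubes, so thin annuli that are charged for one factor of a
product measure are charged for the product. -/
lemma mem_thinAnnuliSet_pi {d : ℕ} (ν : Fin d → Measure ℝ) [∀ i, IsProbabilityMeasure (ν i)]
    {x : Fin d → ℝ} {δ η θ : ℝ} (hδ : 1 ≤ δ) (hη : 0 ≤ η) (hθ : θ ≤ 1 - η) (hη1 : η ≤ 1) (i : Fin d)
    (h : ∀ ε : ℝ, 0 < ε → ∃ r : ℝ, 0 < r ∧ r < ε ∧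
      ν i (Metric.closedBall (x i) (r - r ^ δ)) ≤
        ENNReal.ofReal θ * ν i (Metric.closedBall (x i) r)) :
    x ∈ thinAnnuliSet (Measure.pi ν) δ η := by
  choose r hr0 hr h using fun n : ℕ => h (1 / ((n : ℝ) + 1)) (by positivity)
  have hr1 : ∀ n, r n < 1 := fun n => (hr n).trans_le <| by
    rw [div_le_one (by positivity)]
    linarith [(Nat.cast_nonneg n : (0 : ℝ) ≤ n)]
  refine ⟨r, fun n => ⟨hr0 n, hr1 n⟩, squeeze_zero (fun n => (hr0 n).le) (fun n => (hr n).le)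
    tendsto_one_div_add_atTop_nhds_zero_nat, fun n => ?_⟩
  have hrδ : r n ^ δ ≤ r n := by
    simpa using Real.rpow_le_rpow_of_exponent_ge (hr0 n) (hr1 n).le hδ
  have hrδ0 : 0 ≤ r n ^ δ := Real.rpow_nonneg (hr0 n).le _
  have hinner : Measure.pi ν (Metric.closedBall x (r n - r n ^ δ)) ≤
      ENNReal.ofReal (1 - η) * Measure.pi ν (Metric.closedBall x (r n)) := by
    rw [pi_closedBall ν x (sub_nonneg.2 hrδ), pi_closedBall ν x (hr0 n).le,
      ← Finset.mul_prod_erase _ _ (Finset.mem_univ i),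
      ← Finset.mul_prod_erase Finset.univ (fun i => ν i (Metric.closedBall (x i) (r n)))
        (Finset.mem_univ i), ← mul_assoc]
    gcongr with j
    · exact (h n).trans (by gcongr)
    · linarith
  rw [AnnulusCharged, annulus, measure_sdiff
    (Metric.closedBall_subset_closedBall (by linarith))
    Metric.isClosed_closedBall.measurableSet.nullMeasurableSet (measure_ne_top _ _)]
  apply ENNReal.le_sub_of_add_le_right (measure_ne_top _ _)
  calc _ ≤ ENNReal.ofReal η * Measure.pi ν (Metric.closedBall x (r n)) +
        ENNReal.ofReal (1 - η) * Measure.pi ν (Metric.closedBall x (r n)) := by gcongr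
    _ = _ := by
      rw [← add_mul, ← ENNReal.ofReal_add hη (by linarith)]
      simp

/-- An almost everywhere property of each coordinate holds almost everywhere for all of them. -/
lemma ae_pi_forall {ι : Type*} [Fintype ι] (ν : ι → Measure ℝ) [∀ i, IsProbabilityMeasure (ν i)]
    {p : ι → ℝ → Prop} (h : ∀ i, ∀ᵐ y ∂ν i, p i y) : ∀ᵐ x ∂Measure.pi ν, ∀ i, p i (x i) :=
  ae_all_iff.2 fun i => Measure.tendsto_eval_ae_ae.eventually (h i)

theorem theorem3 (d : ℕ) (hd : 2 ≤ d) (dl du : ℝ) (hdl0 : 0 ≤ dl) (hdl : dl ≤ (d : ℝ) - 1)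
    (hdldu : dl ≤ du) (hdu : du ≤ (d : ℝ)) (η : ℝ) (hη0 : 0 < η) (hη1 : η < 1)
    (δ : ℝ) (hδ : 1 < δ) :
    ∃ μ : Measure (Fin d → ℝ), IsProbabilityMeasure μ ∧ (∀ x, μ {x} = 0) ∧
      lowerDim μ = (dl : EReal) ∧ upperDim μ = (du : EReal) ∧
      NullMeasurableSet (thinAnnuliSet μ δ η) μ ∧ μ (thinAnnuliSet μ δ η) = 1 := by
  obtain ⟨n, rfl⟩ : ∃ n, d = n + 1 := ⟨d - 1, by omega⟩
  have hn : (1 : ℝ) ≤ n := by exact_mod_cast (by omega : 1 ≤ n)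
  push_cast at hdl hdu
  rw [add_sub_cancel_right] at hdl
  -- the high rate `t` of the first coordinate and `u` of the others, with `t + n * u = du`
  obtain ⟨t, u, ht0, ht1, hsu, hu1, htu⟩ : ∃ t u : ℝ, 0 ≤ t ∧ t ≤ 1 ∧ dl / n ≤ u ∧ u ≤ 1 ∧
      t + n * u = du := by
    rcases le_total du n with h | h
    · refine ⟨0, du / n, le_rfl, zero_le_one, by gcongr, ?_, by field⟩
      rw [div_le_one (by linarith)]
      exact h
    · refine ⟨du - n, 1, by linarith, by linarith, ?_, le_rfl, by ring⟩
      rw [div_le_one (by linarith)]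
      exact hdl
  have hs0 : 0 ≤ dl / n := by positivity
  have hns : n * (dl / n) = dl := by field
  obtain ⟨c₀, hc₀⟩ := exists_pow_lt_of_lt_one (sub_pos.2 hη1) (y := (2 : ℝ)⁻¹) (by norm_num)
  -- a value of `c` with `2 ^ (-c) ≤ 1 - η`
  obtain ⟨c, hc1, hc⟩ : ∃ c : ℕ, 1 ≤ c ∧ ((2 : ℝ) ^ c)⁻¹ ≤ 1 - η := by
    refine ⟨c₀ + 1, by omega, le_trans ?_ hc₀.le⟩
    rw [inv_pow]
    gcongr
    · norm_num
    · omega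
  let F : Fin (n + 1) → Set ℕ := Fin.cons (freeScales 0 t) fun _ => freeScales (dl / n) u
  let S : Fin (n + 1) → Set ℕ := Fin.cons biasedScales fun _ => ∅
  let ν : Fin (n + 1) → Measure ℝ := fun i => digitMeasure (digitProb c (F i) (S i))
  have hν : ∀ i, IsProbabilityMeasure (ν i) := fun i => by unfold ν; infer_instance
  let h : ℕ → ℝ := fun k => Nat.count (· ∈ highScales) k
  let s : ℕ → ℝ := fun k => Nat.count (· ∈ biasedScales) k
  let N : ℕ → ℝ := fun k => ∑ i, (Nat.count (· ∈ F i) k : ℝ)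
  have hh0 : ∀ k, 0 ≤ h k := fun k => Nat.cast_nonneg _
  have hhk : ∀ k : ℕ, h k ≤ k := fun k => Nat.cast_le.2 (Nat.count_le _)
  -- the total number of free digits follows the rate `dl`, or `du` at high positions
  have hN : ∀ k : ℕ, dl * k + (du - dl) * h k - (n + 1) ≤ N k ∧
      N k ≤ dl * k + (du - dl) * h k := by
    intro k
    have e : dl * k + (du - dl) * h k = cumulRate 0 t k + n * cumulRate (dl / n) u k := by
      unfold cumulRate
      linear_combination (k - h k) * (- hns) - h k * htu
    have e' : N k = ⌊cumulRate 0 t k⌋₊ + n * ⌊cumulRate (dl / n) u k⌋₊ := by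
      simp only [N, F, Fin.sum_univ_succ, Fin.cons_zero, Fin.cons_succ]
      rw [count_freeScales le_rfl zero_le_one ht0 ht1,
        count_freeScales hs0 (hsu.trans hu1) (hs0.trans hsu) hu1]
      simp
    have h1 := Nat.floor_le (cumulRate_nonneg le_rfl ht0 k)
    have h2 := Nat.floor_le (cumulRate_nonneg hs0 (hs0.trans hsu) k)
    have h3 := (Nat.lt_floor_add_one (cumulRate 0 t k)).le
    have h4 := (Nat.lt_floor_add_one (cumulRate (dl / n) u k)).le
    rw [e, e']
    constructor <;> nlinarith
  have hle : ∀ᵐ x ∂Measure.pi ν, ∀ k : ℕ,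
      Measure.pi ν (Metric.closedBall x ((2 : ℝ) ^ k)⁻¹) ≤
        ENNReal.ofReal ((2 : ℝ) ^ (-(N k - (n + 1) * 2))) := by
    refine .of_forall fun x k => ?_
    have e : -(N k - (n + 1) * 2) = ∑ i : Fin (n + 1), (2 - (Nat.count (· ∈ F i) k : ℝ)) := by
      simp [N]
    rw [pi_closedBall ν x (by positivity), e, ofReal_two_rpow_sum]
    exact Finset.prod_le_prod' fun i _ => digitMeasure_digitProb_closedBall_le hc1 _ _ _ k
  have hge : ∀ᵐ x ∂Measure.pi ν, ∀ k : ℕ,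
      ENNReal.ofReal ((2 : ℝ) ^ (-(N k + (n + 1) * (c * s k)))) ≤
        Measure.pi ν (Metric.closedBall x ((2 : ℝ) ^ k)⁻¹) := by
    filter_upwards [ae_pi_forall ν fun i =>
      ae_le_digitMeasure_digitProb_closedBall hc1 (F i) (S i)] with x hx k
    have e : -(N k + (n + 1) * (c * s k)) =
        ∑ i : Fin (n + 1), -((Nat.count (· ∈ F i) k : ℝ) + c * s k) := by
      rw [Finset.sum_neg_distrib, Finset.sum_add_distrib]
      simp [N]
    rw [pi_closedBall ν x (by positivity), e, ofReal_two_rpow_sum]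
    refine Finset.prod_le_prod' fun i _ => le_trans ?_ (hx i k)
    have hS : (Nat.count (· ∈ S i) k : ℝ) ≤ s k := by
      refine Nat.cast_le.2 (Nat.count_mono_left fun j _ hj => ?_)
      revert hj
      refine Fin.cases (fun h => h) (fun _ h => h.elim) i
    gcongr
    exact one_le_two
  have hae : ∀ᵐ x ∂Measure.pi ν, x ∈ thinAnnuliSet (Measure.pi ν) δ η := by
    have h0 : ∀ᵐ y ∂ν 0, _ := ae_exists_inner_ball (c := c) t (zero_lt_one.trans hδ)
    filter_upwards [Measure.tendsto_eval_ae_ae.eventually h0] with x hx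
    exact mem_thinAnnuliSet_pi ν hδ.le hη0.le hc hη1.le 0 hx
  have hdd : 0 ≤ du - dl := by linarith
  -- the bounded terms and the biased digits do not affect the densities
  have hconst : ∀ C ε : ℝ, 0 < ε → ∀ᶠ k : ℕ in atTop, C ≤ ε * k := fun C ε hε => by
    filter_upwards [(tendsto_natCast_atTop_atTop (R := ℝ)).eventually_ge_atTop (C / ε)] with k hk
    rwa [div_le_iff₀' hε] at hk
  have hbias : ∀ ε : ℝ, 0 < ε → ∀ᶠ k : ℕ in atTop, (n + 1) * (c * s k) ≤ ε * k := by
    intro ε hε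
    have hcn : 0 < (n + 1 : ℝ) * c := by
      have : (1 : ℝ) ≤ c := by exact_mod_cast hc1
      positivity
    filter_upwards [eventually_count_biasedScales_le (div_pos hε hcn)] with k hk
    calc (n + 1) * (c * s k) = (n + 1) * c * s k := by ring
      _ ≤ (n + 1) * c * (ε / ((n + 1) * c) * k) := by gcongr
      _ = ε * k := by field
  refine ⟨Measure.pi ν, inferInstance, fun x => ?_, ?_, ?_, ?_, ?_⟩
  · by_cases hx : x ∈ thinAnnuliSet (Measure.pi ν) δ η
    · exact measure_singleton_of_mem_thinAnnuliSet hδ.le hη0 hx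
    · exact measure_mono_null (Set.singleton_subset_iff.2 hx) (ae_iff.1 hae)
  · refine lowerDim_eq_of_dyadic hle hge (fun ε hε => ?_) fun ε hε => ?_
    · filter_upwards [hconst ((n + 1) * 3) ε hε] with k hk
      have := mul_nonneg hdd (hh0 k)
      linarith [(hN k).1]
    · have hε' : 0 < ε / 2 / (du - dl + 1) := by positivity
      refine ((frequently_count_highScales_le hε').and_eventually
        (hbias (ε / 2) (by positivity))).mono fun k ⟨hk, hk'⟩ => ?_
      have h1 : (du - dl) * h k ≤ ε / 2 * k := by
        calc (du - dl) * h k ≤ (du - dl + 1) * (ε / 2 / (du - dl + 1) * k) := by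
              gcongr
              linarith
          _ = ε / 2 * k := by field
      linarith [(hN k).2]
  · refine upperDim_eq_of_dyadic (hdl0.trans hdldu) hle hge (fun ε hε => ?_) fun ε hε => ?_
    · filter_upwards [hbias ε hε] with k hk
      have := mul_le_mul_of_nonneg_left (hhk k) hdd
      linarith [(hN k).2]
    · have hε' : 0 < ε / 2 / (du - dl + 1) := by positivity
      refine ((frequently_le_count_highScales hε').and_eventually
        (hconst ((n + 1) * 3) (ε / 2) (by positivity))).mono fun k ⟨hk, hk'⟩ => ?_
      have h1 : (du - dl) * (k - h k) ≤ ε / 2 * k := by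
        have h2 : k - h k ≤ ε / 2 / (du - dl + 1) * k := by
          have hk2 : (1 - ε / 2 / (du - dl + 1)) * k ≤ h k := hk
          linarith
        calc (du - dl) * (k - h k) ≤ (du - dl + 1) * (ε / 2 / (du - dl + 1) * k) := by
              gcongr
              · linarith [hhk k]
              · linarith
          _ = ε / 2 * k := by field
      linarith [(hN k).1]
  · exact (nullMeasurableSet_univ).congr (eventuallyEq_univ.2 hae).symm
  · exact (measure_congr (eventuallyEq_univ.2 hae)).trans measure_univ

end
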